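/- Let $j\colon V\to M$ be an elementary embedding (for the language $\{\in\}$) of the universe $V$ of sets into a transitive class $M$, with critical point a cardinal $\kappa$, and suppose ${}^{2^\kappa}j(\kappa)\subseteq M$, i.e. every function from $2^\kappa$ to $j(\kappa)$ belongs to $M$. A forcing notion is a preordered set $\mathbb{P}$ with a weakest condition $0_{\mathbb{P}}$, where $p\le q$ means that $q$ is stronger than $p$. For an ordinal $\alpha$, in the game $G_\alpha(\mathbb{P})$ two players, Odd and Even, choose conditions $p_\beta\in\mathbb{P}$ for $\beta<\alpha$. Even moves at the even stages (those of the form $\delta+2n$ with $n<\omega$ and $\delta$ zero or a limit ordinal), and Odd at the others; Even must start with $p_0=0_{\mathbb{P}}$. A player whose move $p_\beta$ does not satisfy $p_\gamma\le p_\beta$ for all $\gamma<\beta$ loses immediately; if this never happens at any stage $\beta<\alpha$, Even wins. $\mathbb{P}$ is ${<}\kappa$-strategically closed if Even has a winning strategy in $G_\alpha(\mathbb{P})$ for every $\alpha<\kappa$. For $p\in\mathbb{P}$, let $D_p(\mathbb{P})$ be the filter on $\mathbb{P}$ generated by all dense open subsets of $\mathbb{P}$ together with the set $\{q\in\mathbb{P}\mid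 q\ge p\}$. Then for every ${<}\kappa$-strategically closed forcing notion $\mathbb{P}$ of cardinality $\kappa$ and every $p\in\mathbb{P}$, there is a $\kappa$-complete ultrafilter on $\mathbb{P}$ that extends $D_p(\mathbb{P})$. -/

import Mathlib

universe u

namespace StratForcing

open scoped FirstOrder

/-! ### Elementary embeddings of the universe into a transitive class -/

/-- The relation symbols of the language of set theory: one binary symbol. -/
inductive MemRel : ℕ → Type
  | mem : MemRel 2

/-- The first-order language of set theory, `{∈}`. -/
def setLang : FirstOrder.Language.{0, 0} := ⟨fun _ => Empty, MemRel⟩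

/-- The universe of sets `V`, with true membership. -/
instance structureV : setLang.Structure ZFSet.{u} where
  funMap := fun f => Empty.elim f
  RelMap := fun {_} r =>
    match r with
    | MemRel.mem => fun x => x 0 ∈ x 1

/-- A class `M` of sets, with true membership. -/
instance structureClass (M : Set ZFSet.{u}) : setLang.Structure M where
  funMap := fun f => Empty.elim f
  RelMap := fun {_} r =>
    match r with
    | MemRel.mem => fun x => (x 0 : ZFSet.{u}) ∈ (x 1 : ZFSet.{u})

/-- `M` is a transitive class. -/
def IsTransitiveClass (M : Set ZFSet.{u}) : Prop :=
  ∀ x ∈ M, ∀ y ∈ x, y ∈ M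

/-- The ordinal `κ` is the critical point of `j : V → M`: the least ordinal moved by `j`. -/
def IsCriticalPoint {M : Set ZFSet.{u}} (j : ZFSet.{u} ↪ₑ[setLang] M) (κ : Ordinal.{u}) : Prop :=
  (∀ α < κ, (j α.toZFSet : ZFSet.{u}) = α.toZFSet) ∧ (j κ.toZFSet : ZFSet.{u}) ≠ κ.toZFSet

/-! ### Forcing notions

A forcing notion is a preorder with a weakest condition. Forcing goes upwards: `p ≤ q` means that `q`
is the stronger condition, so the weakest condition is `⊥`. -/

/-- `D` is a dense open set of conditions. -/
def IsDenseOpen {P : Type u} [Preorder P] (D : Set P) : Prop :=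
  (∀ p, ∃ q ∈ D, p ≤ q) ∧ (∀ p ∈ D, ∀ q, p ≤ q → q ∈ D)

/-- `D_p(P)`: the filter generated by the dense open sets and the set of all `q ≥ p`. -/
def denseFilter (P : Type u) [Preorder P] (p : P) : Filter P :=
  Filter.generate ({D : Set P | IsDenseOpen D} ∪ {{q : P | p ≤ q}})

/-! ### The game `G_α(P)`

Players Odd and Even choose conditions `p β`, `β < α`; Even moves at the even stages, which include
`0` and all limits. Even has to start with the weakest condition. A player who plays a
condition that does not extend all the earlier ones loses at once; if this never happens then
Even wins. A run is given by a function on all ordinals, of which only the values below `α` count. -/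

/-- Even ordinals: those of the form `δ + 2 n` with `δ` zero or a limit ordinal and `n < ω`. -/
def IsEvenStage (β : Ordinal.{u}) : Prop :=
  ∃ δ : Ordinal.{u}, (δ = 0 ∨ Order.IsSuccLimit δ) ∧ ∃ n : ℕ, β = δ + ((2 * n : ℕ) : Ordinal.{u})

section Game

variable {P : Type u} [Preorder P] [OrderBot P]

/-- The move at stage `β` of the run `p` obeys the rules. -/
def IsLegalMove (p : Ordinal.{u} → P) (β : Ordinal.{u}) : Prop :=
  (β = 0 → p β = ⊥) ∧ ∀ γ < β, p γ ≤ p β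

/-- Even wins the run `p` of length `α`: she is never the first to break the rules. -/
def EvenWins (α : Ordinal.{u}) (p : Ordinal.{u} → P) : Prop :=
  ∀ β < α, IsEvenStage β → (∀ γ < β, IsLegalMove p γ) → IsLegalMove p β

/-- A strategy for Even: it maps the sequence of moves before stage `β` to a move at stage `β`.
Its values at odd stages are irrelevant. -/
abbrev Strategy (P : Type u) : Type (u + 1) :=
  (β : Ordinal.{u}) → (Set.Iio β → P) → P

/-- In the run `p` of length `α`, Even plays according to `σ`. -/
def Follows (σ : Strategy P) (α : Ordinal.{u}) (p : Ordinal.{u} → P) : Prop :=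
  ∀ β < α, IsEvenStage β → p β = σ β (fun γ => p γ)

/-- Even has a winning strategy in `G_α(P)`. -/
def IsStrategicallyClosed (P : Type u) [Preorder P] [OrderBot P] (α : Ordinal.{u}) : Prop :=
  ∃ σ : Strategy P, ∀ p : Ordinal.{u} → P, Follows σ α p → EvenWins α p

/-- `P` is `<κ`-strategically closed: Even has a winning strategy in `G_α(P)` for every `α < κ`. -/
def IsLTStrategicallyClosed (P : Type u) [Preorder P] [OrderBot P] (κ : Cardinal.{u}) : Prop :=
  ∀ α < κ.ord, IsStrategicallyClosed P α

end Game

end StratForcing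

open StratForcing

namespace StratForcing

open FirstOrder FirstOrder.Language Ordinal ZFSet

/-! ### Set-theoretic formulas with named variables -/

/-! Suppose some q in j(P) lies above j(p) and in j(D) for every dense open D ⊆ P. Then U = {A ⊆ P |
q ∈ j(A)} is an ultrafilter extending the given filter. It is κ-complete because j adds no indices
to a family of size below κ (`mem_map_codeSet_sInter`).

To find q (`exists_mem_map_denseOpen`), play the game on j(P) for more than 2^κ stages. Enumerate
the dense open sets as D_ξ, ξ < 2^κ. Odd opens with j(p) and then plays an element of j(D_ξ) above
Even's last response, and q is Even's response to the whole sequence. Two facts make this possible.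
First, 2^κ < j(κ) (`two_power_mem_map`): κ is a strong limit, so j(κ) is one in M, and M contains
every subset of κ. Hence M has a strategy for a game of this length. Second, every initial segment
of Odd's play belongs to M, by the closure hypothesis, so that strategy can answer it.

Elementarity speaks only about sets and single formulas. So P is coded with underlying set κ, and
Even's strategy is replaced by a set E of pairs (Odd's moves, response). Its defining property
`HasStrategies` is first-order, holds in V by `hasStrategies_of_isLTStrategicallyClosed`, and passes
to M by `hasStrategies_map`. -/

/-- The membership symbol. -/
def memSymb : setLang.Relations 2 := MemRel.mem

/-- The formula `x i ∈ x k`. -/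
def memF (i k : ℕ) : setLang.Formula ℕ :=
  memSymb.formula₂ (Term.var i) (Term.var k)

/-- The formula `x i = x k`. -/
def eqF (i k : ℕ) : setLang.Formula ℕ :=
  Term.equal (Term.var i) (Term.var k)

/-- The formula `∃ x i, φ`. -/
noncomputable def exF (i : ℕ) (φ : setLang.Formula ℕ) : setLang.Formula ℕ :=
  Formula.iExs Unit (φ.relabel fun k => if k = i then Sum.inr () else Sum.inl k)

/-- The formula `∀ x i, φ`. -/
noncomputable def allF (i : ℕ) (φ : setLang.Formula ℕ) : setLang.Formula ℕ :=
  ∼(exF i ∼φ)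

/-- The formula `∃ x i ∈ x k, φ`. -/
noncomputable def exInF (i k : ℕ) (φ : setLang.Formula ℕ) : setLang.Formula ℕ :=
  exF i (memF i k ⊓ φ)

/-- The formula `∀ x i ∈ x k, φ`. -/
noncomputable def allInF (i k : ℕ) (φ : setLang.Formula ℕ) : setLang.Formula ℕ :=
  allF i (memF i k ⟹ φ)

/-- The formula `x i ⊆ x k`. -/
noncomputable def subF (i k : ℕ) : setLang.Formula ℕ :=
  -- Here and below, bound variables get indices larger than all the free ones, so nothing is
  -- captured.
  allInF (i + k + 1) i (memF (i + k + 1) k)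

/-- The formula `x k = {x i, x l}`. -/
noncomputable def upairF (i l k : ℕ) : setLang.Formula ℕ :=
  memF i k ⊓ memF l k ⊓ allInF (i + k + l + 1) k (eqF (i + k + l + 1) i ⊔ eqF (i + k + l + 1) l)

/-- The formula `x k = (x i, x l)`. -/
noncomputable def pairF (i l k : ℕ) : setLang.Formula ℕ :=
  exInF (i + k + l + 1) k (exInF (i + k + l + 2) k
    (upairF (i + k + l + 1) (i + k + l + 2) k ⊓ upairF i i (i + k + l + 1) ⊓
      upairF i l (i + k + l + 2)))

/-- The formula `(x i, x l) ∈ x k`. -/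
noncomputable def pairMemF (i l k : ℕ) : setLang.Formula ℕ :=
  exInF (i + k + l + 1) k (pairF i l (i + k + l + 1))

/-! ### Absoluteness of the formulas between V and the transitive class M -/

section Realize

variable {M : Set ZFSet.{u}}

@[simp]
theorem realize_memF_V (i k : ℕ) (v : ℕ → ZFSet.{u}) : (memF i k).Realize v ↔ v i ∈ v k := by
  rw [memF, Formula.realize_rel₂]; rfl

@[simp]
theorem realize_memF (i k : ℕ) (v : ℕ → M) :
    (memF i k).Realize v ↔ (v i : ZFSet.{u}) ∈ (v k : ZFSet.{u}) := by
  rw [memF, Formula.realize_rel₂]; rfl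

@[simp]
theorem realize_eqF {X : Type*} [setLang.Structure X] (i k : ℕ) (v : ℕ → X) :
    (eqF i k).Realize v ↔ v i = v k := by
  simp [eqF]

@[simp]
theorem realize_exF {X : Type*} [setLang.Structure X] (i : ℕ) (φ : setLang.Formula ℕ)
    (v : ℕ → X) : (exF i φ).Realize v ↔ ∃ a, φ.Realize (Function.update v i a) := by
  rw [exF, Formula.realize_iExs]
  have key : ∀ a : Unit → X, (Sum.elim v a ∘ fun k => if k = i then Sum.inr () else Sum.inl k) =
      Function.update v i (a ()) := by
    intro a; ext k; by_cases h : k = i <;> simp [h]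
  simp only [Formula.realize_relabel, key]
  exact ⟨fun ⟨a, h⟩ => ⟨_, h⟩, fun ⟨a, h⟩ => ⟨fun _ => a, h⟩⟩

@[simp]
theorem realize_allF {X : Type*} [setLang.Structure X] (i : ℕ) (φ : setLang.Formula ℕ)
    (v : ℕ → X) : (allF i φ).Realize v ↔ ∀ a, φ.Realize (Function.update v i a) := by
  simp [allF, Formula.realize_not]

@[simp]
theorem realize_iffF {X : Type*} [setLang.Structure X] (φ ψ : setLang.Formula ℕ)
    (v : ℕ → X) : Formula.Realize (φ ⇔ ψ) v ↔ (φ.Realize v ↔ ψ.Realize v) :=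
  Formula.realize_iff

@[simp]
theorem realize_exInF_V (i k : ℕ) (h : k ≠ i) (φ : setLang.Formula ℕ) (v : ℕ → ZFSet.{u}) :
    (exInF i k φ).Realize v ↔ ∃ a ∈ v k, φ.Realize (Function.update v i a) := by
  simp [exInF, h]

@[simp]
theorem realize_exInF (i k : ℕ) (h : k ≠ i) (φ : setLang.Formula ℕ) (v : ℕ → M) :
    (exInF i k φ).Realize v ↔
      ∃ a : M, (a : ZFSet.{u}) ∈ (v k : ZFSet.{u}) ∧ φ.Realize (Function.update v i a) := by
  simp [exInF, h]

@[simp]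
theorem realize_allInF_V (i k : ℕ) (h : k ≠ i) (φ : setLang.Formula ℕ) (v : ℕ → ZFSet.{u}) :
    (allInF i k φ).Realize v ↔ ∀ a ∈ v k, φ.Realize (Function.update v i a) := by
  simp [allInF, h]

@[simp]
theorem realize_allInF (i k : ℕ) (h : k ≠ i) (φ : setLang.Formula ℕ) (v : ℕ → M) :
    (allInF i k φ).Realize v ↔
      ∀ a : M, (a : ZFSet.{u}) ∈ (v k : ZFSet.{u}) → φ.Realize (Function.update v i a) := by
  simp [allInF, h]

@[simp]
theorem realize_subF_V (i k : ℕ) (v : ℕ → ZFSet.{u}) : (subF i k).Realize v ↔ v i ⊆ v k := by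
  have h1 : i ≠ i + k + 1 := by omega
  have h2 : k ≠ i + k + 1 := by omega
  rw [subF, realize_allInF_V _ _ h1]
  simp [Function.update_of_ne h2, ZFSet.subset_def]

theorem realize_subF (hM : IsTransitiveClass M) (i k : ℕ) (v : ℕ → M) :
    (subF i k).Realize v ↔ (v i : ZFSet.{u}) ⊆ (v k : ZFSet.{u}) := by
  have h1 : i ≠ i + k + 1 := by omega
  have h2 : k ≠ i + k + 1 := by omega
  rw [subF, realize_allInF _ _ h1]
  simp only [realize_memF, Function.update_self, Function.update_of_ne h2, ZFSet.subset_def]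
  exact ⟨fun h w hw => h ⟨w, hM _ (v i).2 _ hw⟩ hw, fun h w hw => h hw⟩

theorem realize_upairF_V (i l k : ℕ) (v : ℕ → ZFSet.{u}) :
    (upairF i l k).Realize v ↔ v k = {v i, v l} := by
  have h1 : i ≠ i + k + l + 1 := by omega
  have h2 : k ≠ i + k + l + 1 := by omega
  have h3 : l ≠ i + k + l + 1 := by omega
  rw [upairF, Formula.realize_inf, Formula.realize_inf, realize_allInF_V _ _ h2]
  simp only [realize_memF_V, realize_eqF, Formula.realize_sup, Function.update_self,
    Function.update_of_ne h1, Function.update_of_ne h3]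
  constructor
  · rintro ⟨⟨ha, hb⟩, h⟩
    ext w
    simp only [ZFSet.mem_pair]
    exact ⟨h w, by rintro (rfl | rfl) <;> assumption⟩
  · intro h; simp [h]

theorem realize_upairF (hM : IsTransitiveClass M) (i l k : ℕ) (v : ℕ → M) :
    (upairF i l k).Realize v ↔ (v k : ZFSet.{u}) = {(v i : ZFSet.{u}), (v l : ZFSet.{u})} := by
  have h1 : i ≠ i + k + l + 1 := by omega
  have h2 : k ≠ i + k + l + 1 := by omega
  have h3 : l ≠ i + k + l + 1 := by omega
  rw [upairF, Formula.realize_inf, Formula.realize_inf, realize_allInF _ _ h2]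
  simp only [realize_memF, realize_eqF, Formula.realize_sup, Function.update_self,
    Function.update_of_ne h1, Function.update_of_ne h3]
  constructor
  · rintro ⟨⟨ha, hb⟩, h⟩
    ext w
    simp only [ZFSet.mem_pair]
    refine ⟨fun hw => ?_, by rintro (rfl | rfl) <;> assumption⟩
    simpa [Subtype.ext_iff] using h ⟨w, hM _ (v k).2 _ hw⟩ hw
  · intro h; simp [h, Subtype.ext_iff]

@[simp]
theorem realize_pairF_V (i l k : ℕ) (v : ℕ → ZFSet.{u}) :
    (pairF i l k).Realize v ↔ v k = pair (v i) (v l) := by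
  have h1 : i ≠ i + k + l + 1 := by omega
  have h2 : k ≠ i + k + l + 1 := by omega
  have h3 : l ≠ i + k + l + 1 := by omega
  have h1' : i ≠ i + k + l + 2 := by omega
  have h2' : k ≠ i + k + l + 2 := by omega
  have h3' : l ≠ i + k + l + 2 := by omega
  have h4 : i + k + l + 1 ≠ i + k + l + 2 := by omega
  rw [pairF, realize_exInF_V _ _ h2]
  simp only [realize_exInF_V _ _ h2', Formula.realize_inf, realize_upairF_V,
    Function.update_self, Function.update_of_ne h1, Function.update_of_ne h3,
    Function.update_of_ne h1', Function.update_of_ne h3', Function.update_of_ne h2,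
    Function.update_of_ne h2', Function.update_of_ne h4]
  constructor
  · rintro ⟨a, ha, b, hb, ⟨h, rfl⟩, rfl⟩
    simp [h, pair]
  · intro h
    exact ⟨{v i}, by simp [h, pair], {v i, v l}, by simp [h, pair], by simp [h, pair]⟩

theorem realize_pairF (hM : IsTransitiveClass M) (i l k : ℕ) (v : ℕ → M) :
    (pairF i l k).Realize v ↔ (v k : ZFSet.{u}) = pair (v i) (v l) := by
  have h1 : i ≠ i + k + l + 1 := by omega
  have h2 : k ≠ i + k + l + 1 := by omega
  have h3 : l ≠ i + k + l + 1 := by omega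
  have h1' : i ≠ i + k + l + 2 := by omega
  have h2' : k ≠ i + k + l + 2 := by omega
  have h3' : l ≠ i + k + l + 2 := by omega
  have h4 : i + k + l + 1 ≠ i + k + l + 2 := by omega
  rw [pairF, realize_exInF _ _ h2]
  simp only [realize_exInF _ _ h2', Formula.realize_inf, realize_upairF hM,
    Function.update_self, Function.update_of_ne h1, Function.update_of_ne h3,
    Function.update_of_ne h1', Function.update_of_ne h3', Function.update_of_ne h2,
    Function.update_of_ne h2', Function.update_of_ne h4]
  constructor
  · rintro ⟨a, ha, b, hb, ⟨h, h'⟩, h''⟩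
    simp [h, h', h'', pair]
  · intro h
    have ha : ({(v i : ZFSet.{u})} : ZFSet.{u}) ∈ (v k : ZFSet.{u}) := by simp [h, pair]
    have hb : ({(v i : ZFSet.{u}), (v l : ZFSet.{u})} : ZFSet.{u}) ∈ (v k : ZFSet.{u}) := by
      simp [h, pair]
    exact ⟨⟨_, hM _ (v k).2 _ ha⟩, ha, ⟨_, hM _ (v k).2 _ hb⟩, hb, by simp [h, pair]⟩

@[simp]
theorem realize_pairMemF_V (i l k : ℕ) (v : ℕ → ZFSet.{u}) :
    (pairMemF i l k).Realize v ↔ pair (v i) (v l) ∈ v k := by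
  have h1 : i ≠ i + k + l + 1 := by omega
  have h2 : k ≠ i + k + l + 1 := by omega
  have h3 : l ≠ i + k + l + 1 := by omega
  rw [pairMemF, realize_exInF_V _ _ h2]
  simp [Function.update_of_ne h1, Function.update_of_ne h3]

theorem realize_pairMemF (hM : IsTransitiveClass M) (i l k : ℕ) (v : ℕ → M) :
    (pairMemF i l k).Realize v ↔ pair (v i : ZFSet.{u}) (v l) ∈ (v k : ZFSet.{u}) := by
  have h1 : i ≠ i + k + l + 1 := by omega
  have h2 : k ≠ i + k + l + 1 := by omega
  have h3 : l ≠ i + k + l + 1 := by omega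
  rw [pairMemF, realize_exInF _ _ h2]
  simp only [realize_pairF hM, Function.update_self, Function.update_of_ne h1,
    Function.update_of_ne h3]
  constructor
  · rintro ⟨a, ha, h⟩
    rwa [← h]
  · intro h
    exact ⟨⟨_, hM _ (v k).2 _ h⟩, h, rfl⟩

end Realize

/-- The formula: `x f` is a function from `x a` to `x b`. -/
noncomputable def funcF (a b f : ℕ) : setLang.Formula ℕ :=
  allInF (a + b + f + 1) f (exInF (a + b + f + 2) a (exInF (a + b + f + 3) b
    (pairF (a + b + f + 2) (a + b + f + 3) (a + b + f + 1)))) ⊓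
  allInF (a + b + f + 1) a (exInF (a + b + f + 2) b
    (pairMemF (a + b + f + 1) (a + b + f + 2) f ⊓
      allInF (a + b + f + 3) b (pairMemF (a + b + f + 1) (a + b + f + 3) f ⟹
        eqF (a + b + f + 3) (a + b + f + 2))))

/-- All quantifiers here are bounded by `x`, `y` or `f`, which makes the notion absolute for
transitive classes. -/
theorem isFunc_iff {x y f : ZFSet.{u}} : IsFunc x y f ↔
    (∀ w ∈ f, ∃ a ∈ x, ∃ b ∈ y, w = pair a b) ∧
      ∀ a ∈ x, ∃ b ∈ y, pair a b ∈ f ∧ ∀ c ∈ y, pair a c ∈ f → c = b := by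
  constructor
  · rintro ⟨h1, h2⟩
    refine ⟨fun w hw => by simpa using h1 hw, fun a ha => ?_⟩
    obtain ⟨b, hb, hb'⟩ := h2 a ha
    exact ⟨b, (pair_mem_prod.1 (h1 hb)).2, hb, fun c _ hc => hb' c hc⟩
  · rintro ⟨h1, h2⟩
    have h3 : f ⊆ prod x y := fun w hw => by simpa using h1 w hw
    refine ⟨h3, fun a ha => ?_⟩
    obtain ⟨b, _, hb, hb'⟩ := h2 a ha
    exact ⟨b, hb, fun c hc => hb' c (pair_mem_prod.1 (h3 hc)).2 hc⟩

section

variable {M : Set ZFSet.{u}}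

@[simp]
theorem realize_funcF_V (a b f : ℕ) (v : ℕ → ZFSet.{u}) :
    (funcF a b f).Realize v ↔ IsFunc (v a) (v b) (v f) := by
  obtain ⟨n, hn⟩ : ∃ n, n = a + b + f := ⟨_, rfl⟩
  have a1 : a ≠ n + 1 := by omega
  have a2 : a ≠ n + 2 := by omega
  have b1 : b ≠ n + 1 := by omega
  have b2 : b ≠ n + 2 := by omega
  have b3 : b ≠ n + 3 := by omega
  have f1 : f ≠ n + 1 := by omega
  have f2 : f ≠ n + 2 := by omega
  have f3 : f ≠ n + 3 := by omega
  simp [funcF, ← hn, isFunc_iff, Formula.realize_imp, a1, a2, b1, b2, b3, f1, f2, f3]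

theorem realize_funcF (hM : IsTransitiveClass M) (a b f : ℕ) (v : ℕ → M) :
    (funcF a b f).Realize v ↔ IsFunc (v a : ZFSet.{u}) (v b) (v f) := by
  obtain ⟨n, hn⟩ : ∃ n, n = a + b + f := ⟨_, rfl⟩
  have a1 : a ≠ n + 1 := by omega
  have a2 : a ≠ n + 2 := by omega
  have b1 : b ≠ n + 1 := by omega
  have b2 : b ≠ n + 2 := by omega
  have b3 : b ≠ n + 3 := by omega
  have f1 : f ≠ n + 1 := by omega
  have f2 : f ≠ n + 2 := by omega
  have f3 : f ≠ n + 3 := by omega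
  have ha : ∀ x ∈ (v a : ZFSet.{u}), x ∈ M := hM _ (v a).2
  have hb : ∀ x ∈ (v b : ZFSet.{u}), x ∈ M := hM _ (v b).2
  have hf : ∀ x ∈ (v f : ZFSet.{u}), x ∈ M := hM _ (v f).2
  simp only [funcF, ← hn, isFunc_iff, Formula.realize_imp, Formula.realize_inf, ne_eq, a1, a2,
    b1, b2, b3, f1, f2, f3, not_false_eq_true, realize_allInF, realize_exInF, realize_pairF hM,
    realize_pairMemF hM, realize_eqF, Function.update_self, Function.update_of_ne, Subtype.forall,
    Subtype.exists, Nat.add_left_cancel_iff, 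
    OfNat.one_ne_ofNat, Nat.reduceEqDiff, Subtype.ext_iff]
  constructor
  · rintro ⟨h1, h2⟩
    refine ⟨fun w hw => ?_, fun x hx => ?_⟩
    · obtain ⟨x, _, hx, y, _, hy, h⟩ := h1 w (hf w hw) hw
      exact ⟨x, hx, y, hy, h⟩
    · obtain ⟨y, _, hy, h, h'⟩ := h2 x (ha x hx) hx
      exact ⟨y, hy, h, fun c hc => h' c (hb c hc) hc⟩
  · rintro ⟨h1, h2⟩
    refine ⟨fun w _ hw => ?_, fun x _ hx => ?_⟩
    · obtain ⟨x, hx, y, hy, h⟩ := h1 w hw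
      exact ⟨x, ha x hx, hx, y, hb y hy, hy, h⟩
    · obtain ⟨y, hy, h, h'⟩ := h2 x hx
      exact ⟨y, hb y hy, hy, h, fun c _ hc => h' c hc⟩

end

/-! ### Transfer of first-order statements along j -/

/-- The assignment listing given sets. -/
noncomputable def env (l : List ZFSet.{u}) (n : ℕ) : ZFSet.{u} := l.getD n ∅

section Transfer

variable {M : Set ZFSet.{u}} (j : ZFSet.{u} ↪ₑ[setLang] M)

theorem realize_comp_env (φ : setLang.Formula ℕ) (l : List ZFSet.{u}) :
    φ.Realize (fun n => j (env l n)) ↔ φ.Realize (env l) :=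
  j.map_formula φ (env l)

theorem map_mem_iff (x y : ZFSet.{u}) : (j x : ZFSet.{u}) ∈ (j y : ZFSet.{u}) ↔ x ∈ y := by
  simpa [env] using realize_comp_env j (memF 0 1) [x, y]

theorem map_subset (hM : IsTransitiveClass M) {x y : ZFSet.{u}} (h : x ⊆ y) :
    (j x : ZFSet.{u}) ⊆ j y := by
  simpa [env, h, realize_subF hM] using realize_comp_env j (subF 0 1) [x, y]

theorem map_empty (hM : IsTransitiveClass M) : (j ∅ : ZFSet.{u}) = ∅ := by
  have := realize_comp_env j (exInF 1 0 (eqF 1 1)) [∅]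
  simp [env] at this
  exact (ZFSet.eq_empty _).2 fun w hw => this w (hM _ (j ∅).2 _ hw) hw

theorem map_insert_self (hM : IsTransitiveClass M) (x : ZFSet.{u}) :
    (j (insert x x) : ZFSet.{u}) = insert (j x : ZFSet.{u}) (j x : ZFSet.{u}) := by
  have := realize_comp_env j (allF 2 (memF 2 1 ⇔ (memF 2 0 ⊔ eqF 2 0))) [x, insert x x]
  simp [env, or_comm, Subtype.ext_iff] at this
  ext w
  rw [ZFSet.mem_insert_iff]
  refine ⟨fun hw => (this w (hM _ (j _).2 _ hw)).1 hw, ?_⟩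
  rintro (rfl | hw)
  · exact (this _ (j x).2).2 (Or.inl rfl)
  · exact (this w (hM _ (j _).2 _ hw)).2 (Or.inr hw)

theorem isOrdinal_map (hM : IsTransitiveClass M) {x : ZFSet.{u}} (hx : x.IsOrdinal) :
    (j x : ZFSet.{u}).IsOrdinal := by
  have h1 := realize_comp_env j (allInF 1 0 (subF 1 0)) [x]
  have h2 := realize_comp_env j (allInF 1 0 (allInF 2 1 (subF 2 1))) [x]
  simp [env, realize_subF hM] at h1 h2
  have h1' := h1.2 fun a ha => hx.subset_of_mem ha
  have h2' := h2.2 fun a ha b hb => (hx.mem ha).subset_of_mem hb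
  rw [isOrdinal_iff_forall_mem_isTransitive]
  refine ⟨fun a ha => h1' a (hM _ (j x).2 _ ha) ha, fun a ha b hb => ?_⟩
  have haM := hM _ (j x).2 _ ha
  exact h2' a haM ha b (hM _ haM _ hb) hb

/-- V satisfies the sentence that intersections exist, hence so does M; by transitivity, what M
takes for the intersection is the true one. `restr_mem` uses the same argument. -/
theorem inter_mem (j : ZFSet.{u} ↪ₑ[setLang] M) (hM : IsTransitiveClass M) {x y : ZFSet.{u}} (hx : x ∈ M) (hy : y ∈ M) :
    x ∩ y ∈ M := by
  have := realize_comp_env j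
    (allF 0 (allF 1 (exF 2 (allF 3 (memF 3 2 ⇔ (memF 3 0 ⊓ memF 3 1)))))) []
  simp at this
  obtain ⟨z, hz, h⟩ := this.2 (fun a b => ⟨a ∩ b, by simp⟩) x hx y hy
  convert hz using 1
  ext w
  rw [ZFSet.mem_inter]
  exact ⟨fun hw => (h w (hM _ hx _ hw.1)).2 hw, fun hw => (h w (hM _ hz _ hw)).1 hw⟩

/-- The restriction of a binary relation to a set. -/
noncomputable def restr (t ξ : ZFSet.{u}) : ZFSet.{u} :=
  ZFSet.sep (fun w => ∃ a ∈ ξ, ∃ b, w = pair a b) t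

theorem restr_mem (j : ZFSet.{u} ↪ₑ[setLang] M) (hM : IsTransitiveClass M) {t ξ : ZFSet.{u}} (ht : t ∈ M) (hξ : ξ ∈ M) :
    restr t ξ ∈ M := by
  have := realize_comp_env j
    (allF 0 (allF 1 (exF 2 (allF 3 (memF 3 2 ⇔
      (memF 3 0 ⊓ exInF 4 1 (exF 5 (pairF 4 5 3)))))))) []
  simp [realize_pairF hM] at this
  obtain ⟨z, hz, h⟩ := this.2 (fun a b => ⟨restr a b, by simp [restr]⟩) t ht ξ hξ
  convert hz using 1
  ext w
  rw [restr, ZFSet.mem_sep]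
  constructor
  · rintro ⟨hw, a, ha, b, rfl⟩
    have hwM := hM _ ht _ hw
    have : ({a, b} : ZFSet.{u}) ∈ pair a b := by simp [pair]
    exact (h _ hwM).2 ⟨hw, a, ha, hM _ hξ _ ha, b, hM _ (hM _ hwM _ this) b (by simp), rfl⟩
  · intro hw
    obtain ⟨h1, a, ha, _, b, _, hb⟩ := (h w (hM _ hz _ hw)).1 hw
    exact ⟨h1, a, ha, b, hb⟩

/-- Each element of `κ` has an injection of its power set into an element of `κ`; quantifiers
range over the values of `i`. -/
def PowersetBounded {X : Type*} (i : X → ZFSet.{u}) (κ : ZFSet.{u}) : Prop :=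
  ∀ l : X, i l ∈ κ → ∃ b : X, i b ∈ κ ∧ ∃ f : X, ∀ A : X, i A ⊆ i l → ∃ y : X, i y ∈ i b ∧
    pair (i A) (i y) ∈ i f ∧ ∀ B : X, i B ⊆ i l → pair (i B) (i y) ∈ i f → i B = i A

theorem powersetBounded_map (hM : IsTransitiveClass M) {κ : ZFSet.{u}}
    (h : PowersetBounded id κ) : PowersetBounded (Subtype.val : M → ZFSet.{u}) (j κ) := by
  have := realize_comp_env j
    (allInF 1 0 (exInF 2 0 (exF 3 (allF 4 (subF 4 1 ⟹ exInF 5 2 (pairMemF 4 5 3 ⊓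
      allF 6 (subF 6 1 ⟹ (pairMemF 6 5 3 ⟹ eqF 6 4)))))))) [κ]
  simp [realize_pairMemF hM, realize_subF hM, env, Formula.realize_imp, -Subtype.forall,
    -Subtype.exists] at this
  simpa [PowersetBounded, Subtype.ext_iff, -Subtype.forall, -Subtype.exists] using this.2 h

/-- For each `α ∈ κ` there is a set `E` coding a strategy that
bounds transfinite sequences of length at most `α` of elements of `κ` in which each term lies
`r`-above the response to the earlier terms; all responses lie `r`-above `p`. Quantifiers
range over the values of `i`. -/
def HasStrategies {X : Type*} (i : X → ZFSet.{u}) (κ r p : ZFSet.{u}) : Prop :=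
  ∀ α : X, i α ∈ κ → ∃ E : X, ∀ t β : X, β = α ∨ i β ∈ i α → IsFunc (i β) κ (i t) →
    (∀ ξ : X, i ξ ∈ i β → ∀ y : X, i y ∈ κ → pair (i ξ) (i y) ∈ i t →
      ∃ s : X, i s ⊆ i t ∧ IsFunc (i ξ) κ (i s) ∧
        ∃ e : X, i e ∈ κ ∧ pair (i s) (i e) ∈ i E ∧ pair (i e) (i y) ∈ r) →
    ∃ e : X, i e ∈ κ ∧ pair (i t) (i e) ∈ i E ∧ pair p (i e) ∈ r ∧
      ∀ ξ : X, i ξ ∈ i β → ∀ y : X, i y ∈ κ → pair (i ξ) (i y) ∈ i t → pair (i y) (i e) ∈ r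

theorem hasStrategies_map (hM : IsTransitiveClass M) {κ r p : ZFSet.{u}}
    (h : HasStrategies id κ r p) :
    HasStrategies (Subtype.val : M → ZFSet.{u}) (j κ) (j r) (j p) := by
  have := realize_comp_env j
    (allInF 3 0 (exF 4 (allF 5 (allF 6 ((eqF 6 3 ⊔ memF 6 3) ⟹ (funcF 6 0 5 ⟹
      (allInF 7 6 (allInF 8 0 (pairMemF 7 8 5 ⟹ exF 9 (subF 9 5 ⊓ (funcF 7 0 9 ⊓
        exInF 10 0 (pairMemF 9 10 4 ⊓ pairMemF 10 8 1))))) ⟹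
      exInF 10 0 (pairMemF 5 10 4 ⊓ (pairMemF 2 10 1 ⊓
        allInF 7 6 (allInF 8 0 (pairMemF 7 8 5 ⟹ pairMemF 8 10 1))))))))))) [κ, r, p]
  simp [realize_pairMemF hM, realize_subF hM, realize_funcF hM, env, Formula.realize_imp,
    -Subtype.forall, -Subtype.exists, -forall_eq_or_imp, -forall_eq] at this
  exact this.2 h

end Transfer

/-! ### Strategies, from the point of view of Even's responses to the moves of Odd -/

/-- Zero and the limits are the multiples of ω, and 2 * δ = δ for these because 2 * ω = ω. -/
theorem isEvenStage_iff_dvd {β : Ordinal.{u}} : IsEvenStage β ↔ 2 ∣ β := by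
  have h2 : ∀ δ : Ordinal.{u}, (δ = 0 ∨ Order.IsSuccLimit δ) ↔ ω ∣ δ := by
    intro δ
    rw [Order.isSuccLimit_iff, isSuccPrelimit_iff_omega0_dvd, isMin_iff_eq_bot, Ordinal.bot_eq_zero]
    rcases eq_or_ne δ 0 with rfl | h
    · simp
    · simp [h]
  constructor
  · rintro ⟨δ, hδ, n, rfl⟩
    refine ⟨δ + n, ?_⟩
    rw [mul_add, mul_omega0_dvd (by norm_num) (by exact_mod_cast natCast_lt_omega0 2) ((h2 δ).1 hδ)]
    push_cast; rfl
  · rintro ⟨ξ, rfl⟩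
    obtain ⟨n, hn⟩ := lt_omega0.1 (mod_lt ξ omega0_ne_zero)
    refine ⟨ω * (ξ / ω), (h2 _).2 (dvd_mul_right _ _), n, ?_⟩
    conv_lhs => rw [← div_add_mod ξ ω]
    rw [mul_add, hn, mul_omega0_dvd (by norm_num) (by exact_mod_cast natCast_lt_omega0 2)
      (dvd_mul_right _ _)]
    push_cast; rfl

theorem not_two_dvd_add_one (ξ : Ordinal.{u}) : ¬ (2 : Ordinal.{u}) ∣ 2 * ξ + 1 := by
  rw [dvd_add_iff (dvd_mul_right _ _)]
  intro h
  exact absurd (le_of_dvd one_ne_zero h) (by norm_num)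

theorem two_mul_add_one_div (ξ : Ordinal.{u}) : (2 * ξ + 1) / 2 = ξ := by
  rw [mul_add_div _ two_ne_zero, div_eq_zero_of_lt one_lt_two, add_zero]

theorem eq_two_mul_or (β : Ordinal.{u}) : ∃ ξ, β = 2 * ξ ∨ β = 2 * ξ + 1 := by
  refine ⟨β / 2, ?_⟩
  have h1 := div_add_mod β 2
  have h2 := mod_lt β (two_ne_zero (α := Ordinal.{u}))
  rw [← one_add_one_eq_two, Order.lt_add_one_iff, Order.le_one_iff, one_add_one_eq_two] at h2
  rcases h2 with h2 | h2 <;> rw [h2] at h1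
  · left; rw [add_zero] at h1; exact h1.symm
  · right; exact h1.symm

section

variable {P : Type u}

open Classical in
/-- The run in which Even follows `σ` and the moves of Odd are `p` followed by the terms of `t`. -/
noncomputable def run (σ : Strategy P) (p : P) (t : Ordinal.{u} → P) (β : Ordinal.{u}) : P :=
  if 2 ∣ β then σ β (fun γ => run σ p t γ.1) else if β = 1 then p else t (β / 2 - 1)
termination_by β
decreasing_by exact γ.2

theorem run_two_mul (σ : Strategy P) (p : P) (t : Ordinal.{u} → P) (ξ : Ordinal.{u}) :
    run σ p t (2 * ξ) = σ (2 * ξ) (fun γ => run σ p t γ) := by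
  rw [run, if_pos (dvd_mul_right _ _)]

theorem run_one (σ : Strategy P) (p : P) (t : Ordinal.{u} → P) : run σ p t (2 * 0 + 1) = p := by
  rw [run, if_neg (not_two_dvd_add_one 0)]; simp

/-- The left summand 1 reserves stage 1, Odd's first move, for `p`; as ξ varies, 1 + ξ takes every
nonzero value exactly once. -/
theorem run_odd (σ : Strategy P) (p : P) (t : Ordinal.{u} → P) (ξ : Ordinal.{u}) :
    run σ p t (2 * (1 + ξ) + 1) = t ξ := by
  rw [run, if_neg (not_two_dvd_add_one _), if_neg, two_mul_add_one_div, add_sub_cancel]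
  intro h
  have h1 := two_mul_add_one_div (1 + ξ)
  rw [h, div_eq_zero_of_lt one_lt_two] at h1
  exact absurd h1.symm (by simp)

/-- Even's response to the sequence `t` of length `β`. -/
noncomputable def response (σ : Strategy P) (p : P) (t : Ordinal.{u} → P) (β : Ordinal.{u}) : P :=
  run σ p t (2 * (1 + β))

theorem eq_zero_or_one_add (η : Ordinal.{u}) : η = 0 ∨ ∃ ξ, η = 1 + ξ := by
  rcases eq_or_ne η 0 with h | h
  · exact Or.inl h
  · exact Or.inr ⟨η - 1, (Ordinal.add_sub_cancel_of_le (Order.one_le_iff_ne_zero.2 h)).symm⟩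

/-- Lets the response to a restriction of a sequence be computed from the whole sequence. -/
theorem response_congr (σ : Strategy P) (p : P) {t t' : Ordinal.{u} → P} {β : Ordinal.{u}}
    (h : ∀ ξ < β, t ξ = t' ξ) : response σ p t β = response σ p t' β := by
  have key : ∀ γ ≤ 2 * (1 + β), run σ p t γ = run σ p t' γ := by
    intro γ
    induction γ using WellFoundedLT.induction with
    | ind γ ih =>
      intro hγ
      obtain ⟨η, rfl | rfl⟩ := eq_two_mul_or γ
      · rw [run_two_mul, run_two_mul]
        congr 1
        funext γ
        exact ih γ γ.2 (γ.2.le.trans hγ)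
      · rcases eq_zero_or_one_add η with rfl | ⟨ξ, rfl⟩
        · rw [run_one, run_one]
        · rw [run_odd, run_odd]
          refine h ξ ?_
          have h1 : 2 * (1 + ξ) < 2 * (1 + β) := lt_of_lt_of_le (lt_add_one _) hγ
          simpa using h1
  exact key _ le_rfl

variable [Preorder P] [OrderBot P]

/-- By induction every move is legal: at even stages because σ wins, at odd stages because Odd's
move extends Even's preceding one, which already extends all earlier moves. For Odd's first move
`p`, the preceding one is ⊥. -/
theorem response_spec {σ : Strategy P} {α : Ordinal.{u}}
    (hσ : ∀ p : Ordinal.{u} → P, Follows σ α p → EvenWins α p) (p : P) {t : Ordinal.{u} → P}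
    {β : Ordinal.{u}} (hβ : 2 * (1 + β) < α) (h : ∀ ξ < β, response σ p t ξ ≤ t ξ) :
    p ≤ response σ p t β ∧ ∀ ξ < β, t ξ ≤ response σ p t β := by
  have hw : EvenWins α (run σ p t) := by
    refine hσ _ fun γ _ hγ => ?_
    obtain ⟨ξ, rfl⟩ := isEvenStage_iff_dvd.1 hγ
    exact run_two_mul ..
  have key : ∀ γ ≤ 2 * (1 + β), IsLegalMove (run σ p t) γ := by
    intro γ
    induction γ using WellFoundedLT.induction with
    | ind γ ih =>
      intro hγ
      obtain ⟨η, rfl | rfl⟩ := eq_two_mul_or γ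
      · exact hw _ (hγ.trans_lt hβ) (isEvenStage_iff_dvd.2 (dvd_mul_right _ _))
          fun γ h => ih γ h (h.le.trans hγ)
      · have hlt : 2 * η < 2 * η + 1 := lt_add_one _
        have hlegal := ih _ hlt (hlt.le.trans hγ)
        have hle : run σ p t (2 * η) ≤ run σ p t (2 * η + 1) := by
          rcases eq_zero_or_one_add η with rfl | ⟨ξ, rfl⟩
          · rw [hlegal.1 (mul_zero 2)]
            exact bot_le
          · rw [run_odd]
            refine h ξ ?_
            have h1 : 2 * (1 + ξ) < 2 * (1 + β) := lt_of_lt_of_le hlt hγ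
            simpa using h1
        refine ⟨fun h0 => absurd h0 (by simp), fun γ hlt' => ?_⟩
        rcases (Order.lt_add_one_iff.1 hlt').lt_or_eq with hlt' | rfl
        · exact (hlegal.2 γ hlt').trans hle
        · exact hle
  have hk := (key _ le_rfl).2
  have hlt : ∀ η < 1 + β, 2 * η + 1 < 2 * (1 + β) := by
    intro η hη
    have : 2 * η + 2 ≤ 2 * (1 + β) := by
      rw [← Ordinal.mul_succ]
      exact mul_le_mul_right (Order.succ_le_of_lt hη) 2
    refine lt_of_lt_of_le ?_ this
    simp
  constructor
  · have := hk _ (hlt 0 (lt_of_lt_of_le zero_lt_one le_self_add))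
    rwa [run_one] at this
  · intro ξ hξ
    have := hk _ (hlt (1 + ξ) (by simpa using hξ))
    rwa [run_odd] at this

end

/-! ### Coding a forcing notion in the universe of sets -/

theorem _root_.ZFSet.IsFunc.mem_dom_iff {x y f : ZFSet.{u}} (hf : IsFunc x y f) (a : ZFSet.{u}) :
    a ∈ x ↔ ∃ b, pair a b ∈ f :=
  ⟨fun h => (hf.2 a h).exists, fun ⟨_, h⟩ => (pair_mem_prod.1 (hf.1 h)).1⟩

/-- With conditions coded by the elements of κ, the underlying set of j(P) is j(κ), the target in
the closure hypothesis. -/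
theorem exists_coding (P : Type u) {κ : Cardinal.{u}} (hcard : Cardinal.mk P = κ) :
    ∃ c : P → ZFSet.{u}, Function.Injective c ∧ ∀ x, x ∈ κ.ord.toZFSet ↔ ∃ a, c a = x := by
  have h : Cardinal.mk P = Cardinal.mk κ.ord.ToType := by rw [hcard, Cardinal.mk_toType,
    Cardinal.card_ord]
  obtain ⟨e⟩ := Cardinal.eq.1 h
  refine ⟨fun a => (ToType.mk.symm (e a) : Set.Iio κ.ord).1.toZFSet, fun a b hab => ?_, fun x => ?_⟩
  · exact e.injective (ToType.mk.symm.injective (Subtype.ext (toZFSet_injective hab)))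
  · rw [mem_toZFSet_iff]
    constructor
    · rintro ⟨a, ha, rfl⟩
      exact ⟨e.symm (ToType.mk ⟨a, ha⟩), by simp⟩
    · rintro ⟨a, rfl⟩
      exact ⟨_, (ToType.mk.symm (e a) : Set.Iio κ.ord).2, rfl⟩

variable {P : Type u}

/-- The set coding a set of conditions. -/
noncomputable def codeSet (c : P → ZFSet.{u}) (K : ZFSet.{u}) (A : Set P) : ZFSet.{u} :=
  ZFSet.sep (fun x => ∃ a ∈ A, c a = x) K

/-- The set coding a preorder. -/
noncomputable def codeLE [Preorder P] (c : P → ZFSet.{u}) (K : ZFSet.{u}) : ZFSet.{u} :=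
  ZFSet.sep (fun x => ∃ a b, a ≤ b ∧ x = pair (c a) (c b)) (prod K K)

section

variable {c : P → ZFSet.{u}} {K : ZFSet.{u}}

theorem mem_codeSet (hc : Function.Injective c) (hK : ∀ x, x ∈ K ↔ ∃ a, c a = x) {A : Set P}
    {a : P} : c a ∈ codeSet c K A ↔ a ∈ A := by
  rw [codeSet, ZFSet.mem_sep]
  constructor
  · rintro ⟨_, b, hb, h⟩
    rwa [← hc h]
  · exact fun h => ⟨(hK _).2 ⟨a, rfl⟩, a, h, rfl⟩

theorem mem_codeLE [Preorder P] (hc : Function.Injective c) (hK : ∀ x, x ∈ K ↔ ∃ a, c a = x)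
    {a b : P} : pair (c a) (c b) ∈ codeLE c K ↔ a ≤ b := by
  rw [codeLE, ZFSet.mem_sep]
  constructor
  · rintro ⟨_, a', b', h, h'⟩
    obtain ⟨h1, h2⟩ := pair_inj.1 h'
    rwa [hc h1, hc h2]
  · exact fun h => ⟨pair_mem_prod.2 ⟨(hK _).2 ⟨a, rfl⟩, (hK _).2 ⟨b, rfl⟩⟩, a, b, h, rfl⟩

open Classical in
/-- The sequence of conditions coded by a set function. -/
noncomputable def decode (c : P → ZFSet.{u}) (p : P) (t : ZFSet.{u}) (ξ : Ordinal.{u}) : P :=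
  if h : ∃ a, pair ξ.toZFSet (c a) ∈ t then h.choose else p

theorem pair_mem_iff_decode (hc : Function.Injective c) (hK : ∀ x, x ∈ K ↔ ∃ a, c a = x) (p : P)
    {t : ZFSet.{u}} {β ξ : Ordinal.{u}} (ht : IsFunc β.toZFSet K t) (hξ : ξ < β) (y : ZFSet.{u}) :
    pair ξ.toZFSet y ∈ t ↔ y = c (decode c p t ξ) := by
  obtain ⟨w, hw, hw'⟩ := ht.2 ξ.toZFSet (toZFSet_mem_toZFSet_iff.2 hξ)
  obtain ⟨a, rfl⟩ := (hK w).1 (pair_mem_prod.1 (ht.1 hw)).2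
  have h : ∃ a, pair ξ.toZFSet (c a) ∈ t := ⟨a, hw⟩
  have h2 : decode c p t ξ = a := by
    rw [decode, dif_pos h]
    exact hc (hw' _ h.choose_spec)
  rw [h2]
  exact ⟨fun h => hw' _ h, fun h => h ▸ hw⟩

theorem hasStrategies_of_isLTStrategicallyClosed [Preorder P] [OrderBot P] {κ : Cardinal.{u}}
    (hκ : Cardinal.aleph0 ≤ κ) (hP : IsLTStrategicallyClosed P κ) (hc : Function.Injective c)
    (hK : ∀ x, x ∈ κ.ord.toZFSet ↔ ∃ a, c a = x) (p : P) :
    HasStrategies id κ.ord.toZFSet (codeLE c κ.ord.toZFSet) (c p) := by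
  intro α' hα'
  obtain ⟨α, hα, rfl⟩ := mem_toZFSet_iff.1 hα'
  have hω : ω ≤ κ.ord := by rwa [← Cardinal.ord_aleph0, Cardinal.ord_le_ord]
  have h1κ : 1 < κ.ord := one_lt_omega0.trans_le hω
  have h2κ : 2 < κ.ord := (natCast_lt_omega0 2).trans_le hω
  -- The game must contain Even's stage 2 * (1 + α); κ, being an infinite cardinal, is closed under
  -- ordinal addition and multiplication.
  have hL : 2 * (1 + α) + 1 < κ.ord :=
    Ordinal.isPrincipal_add_ord hκ (Ordinal.isPrincipal_mul_ord hκ h2κ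
      (Ordinal.isPrincipal_add_ord hκ h1κ hα)) h1κ
  obtain ⟨σ, hσ⟩ := hP _ hL
  set K := κ.ord.toZFSet
  refine ⟨ZFSet.sep (fun z => ∃ s, ∃ β ≤ α, IsFunc β.toZFSet K s ∧
    z = pair s (c (response σ p (decode c p s) β))) (prod (powerset (prod α.toZFSet K)) K), ?_⟩
  intro t β' hβ' ht hlegal
  simp only [id] at hβ' ht hlegal ⊢
  obtain ⟨β, hβ, rfl⟩ : ∃ β ≤ α, β.toZFSet = β' := by
    rcases hβ' with rfl | h
    · exact ⟨α, le_rfl, rfl⟩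
    · obtain ⟨β, hβ, rfl⟩ := mem_toZFSet_iff.1 h
      exact ⟨β, hβ.le, rfl⟩
  have hresp : ∀ ξ < β, response σ p (decode c p t) ξ ≤ decode c p t ξ := by
    intro ξ hξ
    obtain ⟨s, hst, hs, e, he, hse, hey⟩ := hlegal ξ.toZFSet (toZFSet_mem_toZFSet_iff.2 hξ)
      (c (decode c p t ξ)) ((hK _).2 ⟨_, rfl⟩) ((pair_mem_iff_decode hc hK p ht hξ _).2 rfl)
    obtain ⟨_, s', β', _, hs', h⟩ := ZFSet.mem_sep.1 hse
    obtain ⟨rfl, rfl⟩ := pair_inj.1 h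
    -- Both are the domain of the same function.
    have hβξ : β' = ξ := by
      apply toZFSet_injective
      ext a
      rw [hs'.mem_dom_iff, hs.mem_dom_iff]
    subst hβξ
    rw [mem_codeLE hc hK] at hey
    refine le_trans (le_of_eq (response_congr σ p fun η hη => ?_)) hey
    apply hc
    exact ((pair_mem_iff_decode hc hK p ht (hη.trans hξ) _).1
      (hst ((pair_mem_iff_decode hc hK p hs hη _).2 rfl))).symm
  have hlt : 2 * (1 + β) < 2 * (1 + α) + 1 := by
    rw [Order.lt_add_one_iff]
    exact mul_le_mul_right (add_le_add_right hβ 1) 2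
  obtain ⟨h1, h2⟩ := response_spec hσ p hlt hresp
  have hmem : c (response σ p (decode c p t) β) ∈ K := (hK _).2 ⟨_, rfl⟩
  refine ⟨_, hmem, ZFSet.mem_sep.2 ⟨pair_mem_prod.2 ⟨ZFSet.mem_powerset.2 fun w hw => ?_, hmem⟩,
    t, β, hβ, ht, rfl⟩, (mem_codeLE hc hK).2 h1, ?_⟩
  · obtain ⟨a, ha, b, hb, rfl⟩ := ZFSet.mem_prod.1 (ht.1 hw)
    exact pair_mem_prod.2 ⟨toZFSet_subset_toZFSet_iff.2 hβ ha, hb⟩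
  · intro ξ' hξ' y _ hy
    obtain ⟨ξ, hξ, rfl⟩ := mem_toZFSet_iff.1 hξ'
    rw [(pair_mem_iff_decode hc hK p ht hξ y).1 hy, mem_codeLE hc hK]
    exact h2 ξ hξ

end

/-! ### Critical points -/

section

variable {M : Set ZFSet.{u}} {j : ZFSet.{u} ↪ₑ[setLang] M} {κ : Cardinal.{u}}

theorem map_eq_of_mem_crit (hcrit : IsCriticalPoint j κ.ord) {x : ZFSet.{u}}
    (hx : x ∈ κ.ord.toZFSet) : (j x : ZFSet.{u}) = x := by
  obtain ⟨α, hα, rfl⟩ := mem_toZFSet_iff.1 hx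
  exact hcrit.1 α hα

/-- Zero and successors are definable, so j fixes every finite ordinal. -/
theorem aleph0_le_crit (hM : IsTransitiveClass M) (hcrit : IsCriticalPoint j κ.ord) :
    Cardinal.aleph0 ≤ κ := by
  by_contra! h
  obtain ⟨n, rfl⟩ := Cardinal.lt_aleph0.1 h
  apply hcrit.2
  rcases n with _ | n
  · simpa using map_empty j hM
  · have h1 := hcrit.1 n (by rw [Cardinal.ord_natCast]; exact_mod_cast n.lt_succ_self)
    rw [Cardinal.ord_natCast, Nat.cast_succ, toZFSet_add_one, map_insert_self j hM, h1]

theorem subset_map_crit (hcrit : IsCriticalPoint j κ.ord) :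
    κ.ord.toZFSet ⊆ (j κ.ord.toZFSet : ZFSet.{u}) := by
  intro x hx
  rw [← map_eq_of_mem_crit hcrit hx]
  exact (map_mem_iff j _ _).2 hx

theorem crit_mem_map (hM : IsTransitiveClass M) (hcrit : IsCriticalPoint j κ.ord) :
    κ.ord.toZFSet ∈ (j κ.ord.toZFSet : ZFSet.{u}) := by
  rcases ((isOrdinal_toZFSet κ.ord).subset_iff_eq_or_mem
    (isOrdinal_map j hM (isOrdinal_toZFSet κ.ord))).1 (subset_map_crit hcrit) with h | h
  · exact absurd h.symm hcrit.2
  · exact h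

theorem map_eq_of_subset (hM : IsTransitiveClass M) (hcrit : IsCriticalPoint j κ.ord)
    {A l : ZFSet.{u}} (hl : l ∈ κ.ord.toZFSet) (hA : A ⊆ l) : (j A : ZFSet.{u}) = A := by
  have h : ∀ x ∈ l, (j x : ZFSet.{u}) = x := fun x hx =>
    map_eq_of_mem_crit hcrit ((isOrdinal_toZFSet κ.ord).mem_trans hx hl)
  ext x
  constructor
  · intro hx
    have h1 := map_subset j hM hA hx
    rw [map_eq_of_mem_crit hcrit hl] at h1
    rwa [← h x h1, map_mem_iff] at hx
  · intro hx
    rw [← h x (hA hx)]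
    exact (map_mem_iff j _ _).2 hx

/-- Otherwise some partial function f maps subsets of l onto κ. Then j(f) maps subsets of j(l) = l
onto j(κ), so it sends some A ⊆ l to κ ∈ j(κ). But j(A) = A, so j(f) can take at A only a value j(y)
= y with y ∈ κ. -/
theorem two_power_lt_crit (hM : IsTransitiveClass M) (hcrit : IsCriticalPoint j κ.ord)
    {l : ZFSet.{u}} (hl : l ∈ κ.ord.toZFSet) : 2 ^ l.card < κ := by
  by_contra! hle
  obtain ⟨c, hc, hK⟩ := exists_coding κ.out (Cardinal.mk_out κ)
  rw [← card_powerset, ← Cardinal.mk_out κ, ZFSet.card] at hle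
  obtain ⟨e⟩ := Cardinal.le_def _ _ |>.1 hle
  set i : κ.out → ZFSet.{u} := fun x => ((equivShrink (powerset l)).symm (e x)).1 with hi
  have hinj : Function.Injective i := fun x y hxy =>
    e.injective ((equivShrink _).symm.injective (Subtype.ext hxy))
  have hil : ∀ x, i x ⊆ l := fun x =>
    ZFSet.mem_powerset.1 ((equivShrink (powerset l)).symm (e x)).2
  set f : ZFSet.{u} := ZFSet.range fun x => pair (i x) (c x) with hf
  have h1 := realize_comp_env j
    (allInF 3 0 (exF 4 (subF 4 1 ⊓ pairMemF 4 3 2))) [κ.ord.toZFSet, l, f]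
  simp [realize_pairMemF hM, realize_subF hM, env] at h1
  have hmem := crit_mem_map hM hcrit
  obtain ⟨A, ⟨hAM, hAl'⟩, hA⟩ := h1.2 (fun y hy => by
    obtain ⟨x, rfl⟩ := (hK y).1 hy
    exact ⟨i x, hil x, ZFSet.mem_range_self x⟩) _ (hM _ (j _).2 _ hmem) hmem
  have hAl : A ⊆ (j l : ZFSet.{u}) := hAl'
  rw [map_eq_of_mem_crit hcrit hl] at hAl
  obtain ⟨y, hy, hAy⟩ : ∃ y ∈ κ.ord.toZFSet, ∀ z, pair A z ∈ f → z = y := by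
    by_cases h : ∃ x, i x = A
    · obtain ⟨x, rfl⟩ := h
      refine ⟨c x, (hK _).2 ⟨x, rfl⟩, fun z hz => ?_⟩
      obtain ⟨x', hx'⟩ := ZFSet.mem_range.1 hz
      obtain ⟨h1, rfl⟩ := pair_inj.1 hx'
      rw [hinj h1]
    -- If f is undefined at A, any element of κ serves as y; `l` is one at hand.
    · refine ⟨l, hl, fun z hz => ?_⟩
      obtain ⟨x', hx'⟩ := ZFSet.mem_range.1 hz
      exact absurd ⟨x', (pair_inj.1 hx').1⟩ h
  have h2 := realize_comp_env j (allF 3 (pairMemF 0 3 2 ⟹ eqF 3 1)) [A, y, f]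
  simp [realize_pairMemF hM, env, Formula.realize_imp, Subtype.ext_iff] at h2
  have h3 := h2.2 hAy κ.ord.toZFSet (hM _ (j _).2 _ hmem)
    (by rwa [map_eq_of_subset hM hcrit hl hAl])
  rw [map_eq_of_mem_crit hcrit hy] at h3
  rw [← h3] at hy
  exact ZFSet.mem_irrefl _ hy

theorem powersetBounded_crit (hM : IsTransitiveClass M) (hcrit : IsCriticalPoint j κ.ord) :
    PowersetBounded id κ.ord.toZFSet := by
  intro l hl
  have hlt := two_power_lt_crit hM hcrit hl
  rw [← card_powerset] at hlt
  obtain ⟨c, hc, hK⟩ := exists_coding (Shrink (powerset l)) (κ := (powerset l).card) rfl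
  refine ⟨(powerset l).card.ord.toZFSet, toZFSet_mem_toZFSet_iff.2 (Cardinal.ord_lt_ord.2 hlt),
    ZFSet.range fun x => pair ((equivShrink (powerset l)).symm x).1 (c x), fun A hA => ?_⟩
  have hA' : A ∈ powerset l := ZFSet.mem_powerset.2 hA
  refine ⟨c (equivShrink _ ⟨A, hA'⟩), (hK _).2 ⟨_, rfl⟩, 
    ZFSet.mem_range.2 ⟨equivShrink _ ⟨A, hA'⟩, by simp⟩, ?_⟩
  intro B _ hBy
  obtain ⟨x, hx⟩ := ZFSet.mem_range.1 hBy
  obtain ⟨h1, h2⟩ := pair_inj.1 hx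
  rw [← h1, hc h2]
  simp

/-- In M, the power set of κ ∈ j(κ) injects into some ordinal b ∈ j(κ). All true subsets of κ are in
M, so this injection bounds the true 2^κ by b. -/
theorem two_power_mem_map (hM : IsTransitiveClass M) (hcrit : IsCriticalPoint j κ.ord) :
    (2 ^ κ : Cardinal.{u}).ord.toZFSet ∈ (j κ.ord.toZFSet : ZFSet.{u}) := by
  have hmem := crit_mem_map hM hcrit
  have hKM := hM _ (j _).2 _ hmem
  have hord := isOrdinal_map j hM (isOrdinal_toZFSet κ.ord)
  obtain ⟨b, hb, f, h⟩ :=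
    powersetBounded_map j hM (powersetBounded_crit hM hcrit) ⟨_, hKM⟩ hmem
  obtain ⟨β, hβ⟩ := isOrdinal_iff_mem_range_toZFSet.1 (hord.mem hb)
  -- A = j(A) ∩ κ, since j fixes the elements of κ.
  have hsub : ∀ A ⊆ κ.ord.toZFSet, A ∈ M := by
    intro A hA
    convert inter_mem j hM (j A).2 hKM using 1
    ext x
    rw [ZFSet.mem_inter]
    constructor
    · intro hx
      refine ⟨?_, hA hx⟩
      rw [← map_eq_of_mem_crit hcrit (hA hx)]
      exact (map_mem_iff j _ _).2 hx
    · rintro ⟨hx, hx'⟩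
      rwa [← map_eq_of_mem_crit hcrit hx', map_mem_iff] at hx
  have hle : (powerset κ.ord.toZFSet).card ≤ (b : ZFSet.{u}).card := by
    have h' : ∀ A : powerset κ.ord.toZFSet, ∃ y : (b : ZFSet.{u}), pair A.1 y.1 ∈ (f : ZFSet.{u}) ∧
        ∀ B ⊆ κ.ord.toZFSet, pair B y.1 ∈ (f : ZFSet.{u}) → B = A := by
      rintro ⟨A, hA⟩
      rw [ZFSet.mem_powerset] at hA
      obtain ⟨y, hy, hAy, hB⟩ := h ⟨A, hsub A hA⟩ hA
      exact ⟨⟨y, hy⟩, hAy, fun B hB' hBy => hB ⟨B, hsub B hB'⟩ hB' hBy⟩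
    choose g hg hg' using h'
    refine Cardinal.mk_le_of_injective
      (f := fun x => equivShrink _ (g ((equivShrink _).symm x))) fun x y hxy => ?_
    have hxy := (equivShrink _).injective hxy
    have h1 := hg ((equivShrink _).symm x)
    rw [hxy] at h1
    exact (equivShrink _).symm.injective
      (Subtype.ext (hg' _ _ (ZFSet.mem_powerset.1 (Subtype.prop _)) h1))
  rw [card_powerset, card_toZFSet, Cardinal.card_ord, ← hβ, card_toZFSet, ← Cardinal.ord_le] at hle
  refine (isOrdinal_toZFSet _).mem_of_subset_of_mem hord (y := (b : ZFSet.{u})) ?_ hb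
  rw [← hβ]
  exact toZFSet_subset_toZFSet_iff.2 hle

end

/-! ### Transfinite sequences of sets -/

/-- The sequence of length `β` with terms `T ξ`, as a set. -/
noncomputable def graph (T : Ordinal.{u} → ZFSet.{u}) (β : Ordinal.{u}) : ZFSet.{u} :=
  ZFSet.range fun η : Set.Iio β => pair η.1.toZFSet (T η)

theorem mem_graph {T : Ordinal.{u} → ZFSet.{u}} {β : Ordinal.{u}} {z : ZFSet.{u}} :
    z ∈ graph T β ↔ ∃ η < β, pair η.toZFSet (T η) = z := by
  simp [graph]

theorem pair_mem_graph {T : Ordinal.{u} → ZFSet.{u}} {β ξ : Ordinal.{u}} {y : ZFSet.{u}} :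
    pair ξ.toZFSet y ∈ graph T β ↔ ξ < β ∧ y = T ξ := by
  rw [mem_graph]
  constructor
  · rintro ⟨η, hη, h⟩
    obtain ⟨h1, rfl⟩ := pair_inj.1 h
    rw [← toZFSet_injective h1]
    exact ⟨hη, rfl⟩
  · rintro ⟨h, rfl⟩
    exact ⟨ξ, h, rfl⟩

theorem isFunc_graph {T : Ordinal.{u} → ZFSet.{u}} {β : Ordinal.{u}} {K : ZFSet.{u}}
    (h : ∀ ξ < β, T ξ ∈ K) : IsFunc β.toZFSet K (graph T β) := by
  constructor
  · intro z hz
    obtain ⟨η, hη, rfl⟩ := mem_graph.1 hz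
    exact pair_mem_prod.2 ⟨toZFSet_mem_toZFSet_iff.2 hη, h η hη⟩
  · intro z hz
    obtain ⟨η, hη, rfl⟩ := mem_toZFSet_iff.1 hz
    exact ⟨T η, pair_mem_graph.2 ⟨hη, rfl⟩, fun y hy => (pair_mem_graph.1 hy).2⟩

theorem graph_mono (T : Ordinal.{u} → ZFSet.{u}) {ξ β : Ordinal.{u}} (h : ξ ≤ β) :
    graph T ξ ⊆ graph T β := by
  intro z hz
  obtain ⟨η, hη, rfl⟩ := mem_graph.1 hz
  exact mem_graph.2 ⟨η, hη.trans_le h, rfl⟩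

theorem restr_graph {T T' : Ordinal.{u} → ZFSet.{u}} {β δ : Ordinal.{u}} (hβ : β ≤ δ)
    (h : ∀ ξ < β, T' ξ = T ξ) : restr (graph T' δ) β.toZFSet = graph T β := by
  ext z
  rw [restr, ZFSet.mem_sep, mem_graph, mem_graph]
  constructor
  · rintro ⟨⟨η, _, rfl⟩, a, ha, b, hab⟩
    obtain ⟨rfl, -⟩ := pair_inj.1 hab
    rw [toZFSet_mem_toZFSet_iff] at ha
    exact ⟨η, ha, by rw [h η ha]⟩
  · rintro ⟨η, hη, rfl⟩
    exact ⟨⟨η, hη.trans_le hβ, by rw [h η hη]⟩, _, toZFSet_mem_toZFSet_iff.2 hη, _, rfl⟩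

/-- A sequence whose terms are chosen according to `Q`, given the earlier terms. -/
noncomputable def choiceSeq (Q : Ordinal.{u} → ZFSet.{u} → ZFSet.{u} → Prop) (ξ : Ordinal.{u}) :
    ZFSet.{u} :=
  Classical.epsilon (Q ξ (ZFSet.range fun η : Set.Iio ξ => pair η.1.toZFSet (choiceSeq Q η.1)))
termination_by ξ
decreasing_by exact η.2

/-- The recursion never asks whether an admissible term exists; that is checked afterwards, by
induction along the sequence. -/
theorem choiceSeq_spec {Q : Ordinal.{u} → ZFSet.{u} → ZFSet.{u} → Prop} {ξ : Ordinal.{u}}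
    (h : ∃ y, Q ξ (graph (choiceSeq Q) ξ) y) :
    Q ξ (graph (choiceSeq Q) ξ) (choiceSeq Q ξ) := by
  conv => arg 3; rw [choiceSeq]
  exact Classical.epsilon_spec h

theorem exists_enumeration {P : Type u} [Preorder P] {κ : Cardinal.{u}}
    (hcard : Cardinal.mk P = κ) : ∃ D : Ordinal.{u} → Set P, (∀ ξ, IsDenseOpen (D ξ)) ∧
      ∀ A, IsDenseOpen A → ∃ ξ < (2 ^ κ : Cardinal.{u}).ord, D ξ = A := by
  classical
  obtain ⟨c, hc, hK⟩ := exists_coding (Set P) (κ := 2 ^ κ) (by rw [Cardinal.mk_set, hcard])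
  -- Indices that code no dense open set get the whole of P, which is itself dense open.
  refine ⟨fun ξ => if h : ∃ A, IsDenseOpen A ∧ c A = ξ.toZFSet then h.choose else Set.univ,
    fun ξ => ?_, fun A hA => ?_⟩
  · dsimp only
    split_ifs with h
    · exact h.choose_spec.1
    · exact ⟨fun p => ⟨p, trivial, le_rfl⟩, fun _ _ _ _ => trivial⟩
  · obtain ⟨ξ, hξ, h⟩ := mem_toZFSet_iff.1 ((hK _).2 ⟨A, rfl⟩)
    have h' : ∃ A, IsDenseOpen A ∧ c A = ξ.toZFSet := ⟨A, hA, h.symm⟩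
    refine ⟨ξ, hξ, ?_⟩
    exact (dif_pos h').trans (hc (h'.choose_spec.2.trans h))

section

variable {M : Set ZFSet.{u}} {j : ZFSet.{u} ↪ₑ[setLang] M} {κ : Cardinal.{u}}
  {P : Type u} {c : P → ZFSet.{u}} {K : ZFSet.{u}}

theorem map_codeSet_dense [Preorder P] (hM : IsTransitiveClass M) (hc : Function.Injective c)
    (hK : ∀ x, x ∈ K ↔ ∃ a, c a = x) {D : Set P} (hD : IsDenseOpen D) {x : ZFSet.{u}}
    (hx : x ∈ (j K : ZFSet.{u})) :
    ∃ y ∈ (j (codeSet c K D) : ZFSet.{u}), pair x y ∈ (j (codeLE c K) : ZFSet.{u}) := by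
  have h := realize_comp_env j (allInF 3 0 (exInF 4 1 (pairMemF 3 4 2)))
    [K, codeSet c K D, codeLE c K]
  simp [realize_pairMemF hM, env] at h
  obtain ⟨y, hy, _, h⟩ := h.2 (fun x hx => by
    obtain ⟨a, rfl⟩ := (hK x).1 hx
    obtain ⟨b, hb, hab⟩ := hD.1 a
    exact ⟨c b, (mem_codeSet hc hK).2 hb, (mem_codeLE hc hK).2 hab⟩) x (hM _ (j K).2 _ hx) hx
  exact ⟨y, hy, h⟩

theorem map_codeSet_open [Preorder P] (hM : IsTransitiveClass M) (hc : Function.Injective c)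
    (hK : ∀ x, x ∈ K ↔ ∃ a, c a = x) {D : Set P} (hD : IsDenseOpen D) {x y : ZFSet.{u}}
    (hx : x ∈ (j (codeSet c K D) : ZFSet.{u})) (hy : y ∈ (j K : ZFSet.{u}))
    (hxy : pair x y ∈ (j (codeLE c K) : ZFSet.{u})) : y ∈ (j (codeSet c K D) : ZFSet.{u}) := by
  have h := realize_comp_env j (allInF 3 1 (allInF 4 0 (pairMemF 3 4 2 ⟹ memF 4 1)))
    [K, codeSet c K D, codeLE c K]
  simp [realize_pairMemF hM, env, Formula.realize_imp] at h
  refine h.2 (fun x hx y hy hxy => ?_) x (hM _ (j _).2 _ hx) hx y (hM _ (j _).2 _ hy) hy hxy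
  obtain ⟨a, rfl⟩ := (hK x).1 (ZFSet.mem_sep.1 hx).1
  obtain ⟨b, rfl⟩ := (hK y).1 hy
  rw [mem_codeSet hc hK] at hx ⊢
  exact hD.2 a hx b ((mem_codeLE hc hK).1 hxy)

theorem codeSet_subset (A : Set P) : codeSet c K A ⊆ K := fun _ h => (ZFSet.mem_sep.1 h).1

/-- There is a condition of `j P` above `j p` lying in `j D` for all dense open `D`. -/
theorem exists_mem_map_denseOpen [Preorder P] [OrderBot P] (hM : IsTransitiveClass M)
    (hcrit : IsCriticalPoint j κ.ord)
    (hclosed : ∀ f ∈ ZFSet.funs (2 ^ κ : Cardinal.{u}).ord.toZFSet (j κ.ord.toZFSet : ZFSet.{u}),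
      f ∈ M)
    (hcard : Cardinal.mk P = κ) (hP : IsLTStrategicallyClosed P κ) (hc : Function.Injective c)
    (hK : ∀ x, x ∈ κ.ord.toZFSet ↔ ∃ a, c a = x) (p : P) :
    ∃ q ∈ (j κ.ord.toZFSet : ZFSet.{u}),
      pair (j (c p) : ZFSet.{u}) q ∈ (j (codeLE c κ.ord.toZFSet) : ZFSet.{u}) ∧
      ∀ D : Set P, IsDenseOpen D → q ∈ (j (codeSet c κ.ord.toZFSet D) : ZFSet.{u}) := by
  have hδ := two_power_mem_map hM hcrit
  set K := κ.ord.toZFSet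
  set δ := (2 ^ κ : Cardinal.{u}).ord
  have hδM : δ.toZFSet ∈ M := hM _ (j K).2 _ hδ
  have hβM : ∀ β ≤ δ, β.toZFSet ∈ M := fun β hβ => by
    rcases hβ.lt_or_eq with h | rfl
    · exact hM _ hδM _ (toZFSet_mem_toZFSet_iff.2 h)
    · exact hδM
  obtain ⟨E, hE⟩ := hasStrategies_map j hM
    (hasStrategies_of_isLTStrategicallyClosed (aleph0_le_crit hM hcrit) hP hc hK p) ⟨_, hδM⟩ hδ
  obtain ⟨D, hD, hDs⟩ := exists_enumeration hcard
  set r := (j (codeLE c K) : ZFSet.{u})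
  -- `y` is an admissible move for Odd after `s`: it meets the ξ-th requirement and extends a
  -- response that E gives to `s`.
  set Q : Ordinal.{u} → ZFSet.{u} → ZFSet.{u} → Prop := fun ξ s y =>
    y ∈ (j (codeSet c K (D ξ)) : ZFSet.{u}) ∧
      ∃ e ∈ (j K : ZFSet.{u}), pair s e ∈ (E : ZFSet.{u}) ∧ pair e y ∈ r
  set T := choiceSeq Q
  have hTK : ∀ ξ, Q ξ (graph T ξ) (T ξ) → T ξ ∈ (j K : ZFSet.{u}) := fun ξ h =>
    map_subset j hM (codeSet_subset _) h.1
  -- The closure hypothesis covers only functions on all of 2^κ, so the segment is padded with j(c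
  -- p) to length δ and then cut back inside M.
  have hgM : ∀ β ≤ δ, (∀ ξ < β, T ξ ∈ (j K : ZFSet.{u})) → graph T β ∈ M := by
    intro β hβ h
    classical
    set T' : Ordinal.{u} → ZFSet.{u} := fun ξ => if ξ < β then T ξ else (j (c p) : ZFSet.{u})
      with hT'
    have h1 : graph T' δ ∈ M := by
      refine hclosed _ (ZFSet.mem_funs.2 (isFunc_graph fun ξ _ => ?_))
      by_cases hξ : ξ < β
      · simpa [hT', hξ] using h ξ hξ
      · simpa [hT', hξ] using (map_mem_iff j _ _).2 ((hK _).2 ⟨p, rfl⟩)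
    have h2 := restr_mem j hM h1 (hβM β hβ)
    rwa [restr_graph hβ fun ξ hξ => if_pos hξ] at h2
  have hstep : ∀ β ≤ δ, (∀ ξ < β, Q ξ (graph T ξ) (T ξ)) →
      ∃ e ∈ (j K : ZFSet.{u}), pair (graph T β) e ∈ (E : ZFSet.{u}) ∧ pair (j (c p)) e ∈ r ∧
        ∀ ξ < β, pair (T ξ) e ∈ r := by
    intro β hβ h
    have hT : ∀ ξ < β, T ξ ∈ (j K : ZFSet.{u}) := fun ξ hξ => hTK ξ (h ξ hξ)
    obtain ⟨e, heK, h1, h2, h3⟩ := hE ⟨_, hgM β hβ hT⟩ ⟨_, hβM β hβ⟩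
      (by
        rcases hβ.lt_or_eq with h | rfl
        · exact Or.inr (toZFSet_mem_toZFSet_iff.2 h)
        · exact Or.inl rfl)
      (isFunc_graph hT)
      (by
        intro ξ' hξ' y hy hξy
        obtain ⟨ξ, hξ, hξξ'⟩ := mem_toZFSet_iff.1 hξ'
        rw [← hξξ'] at hξy ⊢
        obtain ⟨_, e, he, h1, h2⟩ := h ξ hξ
        have hT' : ∀ η < ξ, T η ∈ (j K : ZFSet.{u}) := fun η hη => hT η (hη.trans hξ)
        refine ⟨⟨_, hgM ξ (hξ.le.trans hβ) hT'⟩, graph_mono T hξ.le, isFunc_graph hT',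
          ⟨e, hM _ (j K).2 _ he⟩, he, h1, ?_⟩
        rwa [(pair_mem_graph.1 hξy).2])
    refine ⟨e, heK, h1, h2, fun ξ hξ => ?_⟩
    exact h3 ⟨_, hβM ξ (hξ.le.trans hβ)⟩ (toZFSet_mem_toZFSet_iff.2 hξ)
      ⟨T ξ, hM _ (j K).2 _ (hT ξ hξ)⟩ (hT ξ hξ) (pair_mem_graph.2 ⟨hξ, rfl⟩)
  have hall : ∀ ξ < δ, Q ξ (graph T ξ) (T ξ) := by
    intro ξ
    induction ξ using WellFoundedLT.induction with
    | ind ξ ih =>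
      intro hξ
      obtain ⟨e, heK, he, _⟩ := hstep ξ hξ.le fun η hη => ih η hη (hη.trans hξ)
      obtain ⟨y, hy, hey⟩ := map_codeSet_dense hM hc hK (hD ξ) heK
      exact choiceSeq_spec ⟨y, hy, e, heK, he, hey⟩
  -- E also answers sequences of the full length δ, hence the case β = α in `HasStrategies`.
  obtain ⟨q, hqK, _, hpq, hq⟩ := hstep δ le_rfl hall
  refine ⟨q, hqK, hpq, fun A hA => ?_⟩
  obtain ⟨ξ, hξ, rfl⟩ := hDs A hA
  exact map_codeSet_open hM hc hK hA (hall ξ hξ).1 hqK (hq ξ hξ)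

/-! ### The ultrafilter generated by a condition of `j P` -/

theorem mem_map_codeSet_inter (hM : IsTransitiveClass M) (A B : Set P) {q : ZFSet.{u}}
    (hc : Function.Injective c) (hA : q ∈ (j (codeSet c K A) : ZFSet.{u}))
    (hB : q ∈ (j (codeSet c K B) : ZFSet.{u})) : q ∈ (j (codeSet c K (A ∩ B)) : ZFSet.{u}) := by
  have h := realize_comp_env j (allInF 3 0 (memF 3 1 ⟹ memF 3 2))
    [codeSet c K A, codeSet c K B, codeSet c K (A ∩ B)]
  simp [env, Formula.realize_imp] at h
  refine h.2 (fun x hx hy => ?_) q (hM _ (j _).2 _ hA) hA hB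
  obtain ⟨hx, a, ha, rfl⟩ := ZFSet.mem_sep.1 hx
  obtain ⟨_, b, hb, hab⟩ := ZFSet.mem_sep.1 hy
  exact ZFSet.mem_sep.2 ⟨hx, a, ⟨ha, hc hab ▸ hb⟩, rfl⟩

theorem mem_map_codeSet_compl (hM : IsTransitiveClass M) (A : Set P) {q : ZFSet.{u}}
    (hc : Function.Injective c) (hK : ∀ x, x ∈ K ↔ ∃ a, c a = x) (hq : q ∈ (j K : ZFSet.{u})) :
    q ∈ (j (codeSet c K A) : ZFSet.{u}) ↔ q ∉ (j (codeSet c K Aᶜ) : ZFSet.{u}) := by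
  have h := realize_comp_env j (allInF 3 0 (memF 3 1 ⇔ ∼(memF 3 2)))
    [K, codeSet c K A, codeSet c K Aᶜ]
  simp only [ne_eq, OfNat.zero_ne_ofNat, not_false_eq_true, realize_allInF,
    realize_allInF_V, realize_iffF, realize_memF, realize_memF_V, Formula.realize_not] at h
  refine h.2 (fun x hx => ?_) ⟨q, hM _ (j _).2 _ hq⟩ hq
  obtain ⟨a, rfl⟩ := (hK x).1 hx
  simp [env, mem_codeSet hc hK]

/-- Index the family by l = |S| ∈ κ and code it by a relation R. Since j(l) = l and j fixes each
index, the sections of j(R) are indexed by the members A of S alone, and q ∈ j(A) puts q in each of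
them. -/
theorem mem_map_codeSet_sInter (hM : IsTransitiveClass M) (hcrit : IsCriticalPoint j κ.ord)
    (hc : Function.Injective c) (hK : ∀ x, x ∈ κ.ord.toZFSet ↔ ∃ a, c a = x) {q : ZFSet.{u}}
    (hq : q ∈ (j κ.ord.toZFSet : ZFSet.{u})) (S : Set (Set P)) (hS : Cardinal.mk S < κ)
    (h : ∀ A ∈ S, q ∈ (j (codeSet c κ.ord.toZFSet A) : ZFSet.{u})) :
    q ∈ (j (codeSet c κ.ord.toZFSet (⋂₀ S)) : ZFSet.{u}) := by
  obtain ⟨d, hd, hl⟩ := exists_coding S rfl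
  set K := κ.ord.toZFSet
  set l := (Cardinal.mk S).ord.toZFSet
  have hlK : l ∈ K := toZFSet_mem_toZFSet_iff.2 (Cardinal.ord_lt_ord.2 hS)
  set R : ZFSet.{u} :=
    ZFSet.range fun x : {x : S × P // x.2 ∈ x.1.1} => pair (d x.1.1) (c x.1.2)
  have hR : ∀ (A : S) (a : P), pair (d A) (c a) ∈ R ↔ a ∈ A.1 := by
    intro A a
    rw [ZFSet.mem_range]
    constructor
    · rintro ⟨x, hx⟩
      obtain ⟨h1, h2⟩ := pair_inj.1 hx
      rw [← hd h1, ← hc h2]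
      exact x.2
    · exact fun h => ⟨⟨(A, a), h⟩, rfl⟩
  have hqM := hM _ (j K).2 _ hq
  have h1 := realize_comp_env j (allInF 4 0 (allInF 5 1 (pairMemF 5 4 2) ⟹ memF 4 3))
    [K, l, R, codeSet c K (⋂₀ S)]
  simp [env, Formula.realize_imp, realize_pairMemF hM] at h1
  refine h1.2 (fun x hx hxl => ?_) q hqM hq fun i _ hi => ?_
  · obtain ⟨a, rfl⟩ := (hK x).1 hx
    rw [mem_codeSet hc hK]
    exact fun A hA => (hR ⟨A, hA⟩ a).1 (hxl _ ((hl _).2 ⟨_, rfl⟩))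
  · rw [map_eq_of_mem_crit hcrit hlK] at hi
    obtain ⟨A, rfl⟩ := (hl i).1 hi
    have h2 := realize_comp_env j (allInF 4 0 (memF 4 3 ⟹ pairMemF 1 4 2))
      [K, d A, R, codeSet c K A.1]
    simp [env, Formula.realize_imp, realize_pairMemF hM] at h2
    have h3 := h2.2 (fun x hx hxA => by
      obtain ⟨a, rfl⟩ := (hK x).1 hx
      rw [mem_codeSet hc hK] at hxA
      exact (hR A a).2 hxA) q hqM hq (h A.1 A.2)
    rwa [map_eq_of_mem_crit hcrit ((isOrdinal_toZFSet κ.ord).mem_trans hi hlK)] at h3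

theorem mem_map_codeSet_Ici [Preorder P] (hM : IsTransitiveClass M) (hc : Function.Injective c)
    (hK : ∀ x, x ∈ K ↔ ∃ a, c a = x) {p : P} {q : ZFSet.{u}} (hq : q ∈ (j K : ZFSet.{u}))
    (hpq : pair (j (c p) : ZFSet.{u}) q ∈ (j (codeLE c K) : ZFSet.{u})) :
    q ∈ (j (codeSet c K {x | p ≤ x}) : ZFSet.{u}) := by
  have h := realize_comp_env j (allInF 4 0 (pairMemF 1 4 2 ⟹ memF 4 3))
    [K, c p, codeLE c K, codeSet c K {x | p ≤ x}]
  simp [env, Formula.realize_imp, realize_pairMemF hM] at h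
  refine h.2 (fun x hx hpx => ?_) q (hM _ (j _).2 _ hq) hq hpq
  obtain ⟨a, rfl⟩ := (hK x).1 hx
  exact (mem_codeSet hc hK).2 ((mem_codeLE hc hK).1 hpx)

/-- The ultrafilter of all sets of conditions whose image under `j` contains `q`. -/
noncomputable def conditionUltrafilter (hM : IsTransitiveClass M) (hc : Function.Injective c)
    (hK : ∀ x, x ∈ K ↔ ∃ a, c a = x) {q : ZFSet.{u}} (hq : q ∈ (j K : ZFSet.{u})) :
    Ultrafilter P :=
  Ultrafilter.ofComplNotMemIff
    { sets := {A | q ∈ (j (codeSet c K A) : ZFSet.{u})}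
      univ_sets := by
        have : codeSet c K Set.univ = K := by ext x; simp [codeSet, hK]
        rwa [Set.mem_ofPred_eq, this]
      sets_of_superset := fun {A B} hA hAB => map_subset j hM (x := codeSet c K A) (fun x hx => by
        obtain ⟨hx, a, ha, rfl⟩ := ZFSet.mem_sep.1 hx
        exact ZFSet.mem_sep.2 ⟨hx, a, hAB ha, rfl⟩) hA
      inter_sets := fun {A B} hA hB => mem_map_codeSet_inter hM A B hc hA hB }
    fun A => (mem_map_codeSet_compl hM A hc hK hq).symm

end

end StratForcing

open StratForcing
theorem mainTheorem6 (κ : Cardinal.{u})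
    (M : Set ZFSet.{u}) (hM : IsTransitiveClass M)
    (j : FirstOrder.Language.ElementaryEmbedding setLang ZFSet.{u} M)
    (hcrit : IsCriticalPoint j κ.ord)
    (hclosed : ∀ f ∈ ZFSet.funs (2 ^ κ : Cardinal.{u}).ord.toZFSet (j κ.ord.toZFSet : ZFSet.{u}),
      f ∈ M)
    (P : Type u) [Preorder P] [OrderBot P] (hcard : Cardinal.mk P = κ)
    (hP : IsLTStrategicallyClosed P κ) (p : P) :
    ∃ U : Ultrafilter P, CardinalInterFilter (U : Filter P) κ ∧
      (U : Filter P) ≤ denseFilter P p := by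
  obtain ⟨c, hc, hK⟩ := exists_coding P hcard
  obtain ⟨q, hq, hpq, hD⟩ := exists_mem_map_denseOpen hM hcrit hclosed hcard hP hc hK p
  refine ⟨conditionUltrafilter hM hc hK hq,
    ⟨fun S hS h => mem_map_codeSet_sInter hM hcrit hc hK hq S hS h⟩, ?_⟩
  rw [denseFilter, Filter.le_generate_iff]
  rintro A (hA | rfl)
  · exact hD A hA
  · exact mem_map_codeSet_Ici hM hc hK hq hpq
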